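/- Let $m\ge r$, let $\bar X'$ denote the conjugate transpose of a complex matrix $X$, and let $V_{r,m}^{\mathbb{C}}=\{X\in\mathbb{C}^{m\times r}:\bar X'X=I_r\}$ be the complex Stiefel manifold. The uniform distribution $[\mathrm{d}X]$ on $V_{r,m}^{\mathbb{C}}$ is its normalized invariant measure, i.e. the unique Borel probability measure on $V_{r,m}^{\mathbb{C}}$ that is invariant under $X\mapsto UX$ for all unitary $m\times m$ matrices $U$ (equivalently, the law of the first $r$ columns of a Haar-distributed unitary $m\times m$ matrix). Let $Z$ be an $m\times r$ complex random matrix whose distribution has, with respect to Lebesgue measure on $\mathbb{C}^{m\times r}\cong\mathbb{R}^{2mr}$, a density of the form $Z\mapsto g(\bar Z'Z)$ for some function $g\ge 0$ of an $r\times r$ matrix. Then $Z$ has almost surely full column rank $r$, so that its orientation $$H_Z=Z(\bar Z'Z)^{-1/2}$$ is almost surely well defined and an element of $V_{r,m}^{\mathbb{C}}$, and $H_Z$ is uniformly distributed on $V_{r,m}^{\mathbb{C}}$. -/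

import Mathlib

open MeasureTheory ProbabilityTheory Matrix
open scoped MatrixOrder ComplexOrder

namespace ComplexStiefel

/-- The product (Borel) sigma-algebra on complex `m × r` matrices. -/
noncomputable instance instMeasurableSpaceMatrix (m r : ℕ) : MeasurableSpace (Matrix (Fin m) (Fin r) ℂ) :=
  inferInstanceAs (MeasurableSpace (Fin m → Fin r → ℂ))

instance instBorelSpaceMatrix (m r : ℕ) : BorelSpace (Matrix (Fin m) (Fin r) ℂ) :=
  inferInstanceAs (BorelSpace (Fin m → Fin r → ℂ))

/-- Lebesgue measure `(dZ)` on complex `m × r` matrices: the product over all entries of the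
Lebesgue measure `d(Re z) d(Im z)` on `ℂ`. -/
noncomputable instance instMeasureSpaceMatrix (m r : ℕ) :
    MeasureSpace (Matrix (Fin m) (Fin r) ℂ) where
  volume := (volume : Measure (Fin m → Fin r → ℂ))

/-- The complex Stiefel manifold of semi-unitary `m × r` matrices (used for `r ≤ m`). -/
def stiefel (m r : ℕ) : Set (Matrix (Fin m) (Fin r) ℂ) :=
  {X | Xᴴ * X = 1}

noncomputable instance instMeasurableSpaceUnitary (m : ℕ) :
    MeasurableSpace (Matrix.unitaryGroup (Fin m) ℂ) :=
  Subtype.instMeasurableSpace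

instance instBorelSpaceUnitary (m : ℕ) : BorelSpace (Matrix.unitaryGroup (Fin m) ℂ) :=
  Subtype.borelSpace _

instance instCompactSpaceUnitary (m : ℕ) : CompactSpace (Matrix.unitaryGroup (Fin m) ℂ) := by
  have hc : IsClosed ((Matrix.unitaryGroup (Fin m) ℂ : Set (Matrix (Fin m) (Fin m) ℂ))) :=
    isClosed_unitary
  have hK : IsCompact (Set.univ.pi fun _ : Fin m => Set.univ.pi fun _ : Fin m =>
      Metric.closedBall (0 : ℂ) 1) :=
    isCompact_univ_pi fun _ => isCompact_univ_pi fun _ => isCompact_closedBall _ _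
  refine isCompact_iff_compactSpace.mp (IsCompact.of_isClosed_subset hK hc ?_)
  intro U hU i _ j _
  simpa using entry_norm_bound_of_unitary hU i j

/-- The Haar probability measure on the unitary group `U(m)`. -/
noncomputable def unitaryHaar (m : ℕ) : Measure (Matrix.unitaryGroup (Fin m) ℂ) :=
  Measure.haarMeasure ⊤

instance instIsProbabilityMeasureUnitaryHaar (m : ℕ) : IsProbabilityMeasure (unitaryHaar m) :=
  ⟨by simpa [unitaryHaar] using
    Measure.haarMeasure_self (K₀ := (⊤ : TopologicalSpace.PositiveCompacts
      (Matrix.unitaryGroup (Fin m) ℂ)))⟩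

instance instIsMulLeftInvariantUnitaryHaar (m : ℕ) : (unitaryHaar m).IsMulLeftInvariant :=
  inferInstanceAs (Measure.haarMeasure _).IsMulLeftInvariant

/-- The map sending a unitary `m × m` matrix to the semi-unitary matrix of its first `r` columns. -/
def firstColumns {m r : ℕ} (h : r ≤ m) (U : Matrix.unitaryGroup (Fin m) ℂ) : stiefel m r :=
  ⟨(U : Matrix (Fin m) (Fin m) ℂ).submatrix id (Fin.castLE h), by
    have hU : (U : Matrix (Fin m) (Fin m) ℂ)ᴴ * (U : Matrix (Fin m) (Fin m) ℂ) = 1 :=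
      Matrix.mem_unitaryGroup_iff'.mp U.2
    change _ * _ = _
    rw [conjTranspose_submatrix, ← submatrix_mul _ _ _ _ _ Function.bijective_id, hU,
      submatrix_one _ (Fin.castLE_injective h)]⟩

/-- The uniform distribution `[dX]` on the complex Stiefel manifold, i.e. its normalized measure
invariant under left multiplication by unitary matrices: the image of the Haar probability measure
of `U(m)` under the quotient map to the first `r` columns. -/
noncomputable def stiefelUniform {m r : ℕ} (h : r ≤ m) : Measure (stiefel m r) :=
  (unitaryHaar m).map (firstColumns h)

theorem measurable_firstColumns {m r : ℕ} (h : r ≤ m) : Measurable (firstColumns h) := by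
  refine Continuous.measurable (Continuous.subtype_mk ?_ _)
  exact continuous_subtype_val.matrix_submatrix _ _

instance instIsProbabilityMeasureStiefelUniform {m r : ℕ} (h : r ≤ m) :
    IsProbabilityMeasure (stiefelUniform h) :=
  Measure.isProbabilityMeasure_map (measurable_firstColumns h).aemeasurable

/-- Left multiplication by a unitary matrix on the complex Stiefel manifold. -/
def leftMul {m r : ℕ} (U : Matrix.unitaryGroup (Fin m) ℂ) (X : stiefel m r) : stiefel m r :=
  ⟨(U : Matrix (Fin m) (Fin m) ℂ) * (X : Matrix (Fin m) (Fin r) ℂ), by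
    have hU : (U : Matrix (Fin m) (Fin m) ℂ)ᴴ * (U : Matrix (Fin m) (Fin m) ℂ) = 1 :=
      Matrix.mem_unitaryGroup_iff'.mp U.2
    have hX : (X : Matrix (Fin m) (Fin r) ℂ)ᴴ * (X : Matrix (Fin m) (Fin r) ℂ) = 1 := X.2
    change _ * _ = _
    rw [conjTranspose_mul, Matrix.mul_assoc, ← Matrix.mul_assoc (U : Matrix (Fin m) (Fin m) ℂ)ᴴ, hU,
      Matrix.one_mul, hX]⟩

/-- The uniform distribution is invariant under left multiplication by unitary matrices. -/
theorem stiefelUniform_map_leftMul {m r : ℕ} (h : r ≤ m) (U : Matrix.unitaryGroup (Fin m) ℂ) :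
    (stiefelUniform h).map (leftMul U) = stiefelUniform h := by
  have hm : Measurable (leftMul (r := r) U) := by
    refine Continuous.measurable (Continuous.subtype_mk ?_ _)
    exact continuous_const.matrix_mul continuous_subtype_val
  have hcomp : leftMul U ∘ firstColumns h = firstColumns h ∘ (U * ·) := by
    funext V
    apply Subtype.ext
    ext i j
    simp [leftMul, firstColumns, Matrix.mul_apply]
  rw [stiefelUniform, Measure.map_map hm (measurable_firstColumns h), hcomp,
    ← Measure.map_map (measurable_firstColumns h) (measurable_const_mul U), map_mul_left_eq_self]

/-- The orientation `H_Z = Z (Zᴴ Z)^(-1/2)` of the polar decomposition `Z = H_Z (Zᴴ Z)^(1/2)` of a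
matrix `Z` of full column rank; `CFC.sqrt` is the positive semidefinite square root. -/
noncomputable def orientation {m r : ℕ} (Z : Matrix (Fin m) (Fin r) ℂ) :
    Matrix (Fin m) (Fin r) ℂ :=
  Z * (CFC.sqrt (Zᴴ * Z))⁻¹

end ComplexStiefel

/-!
The Gram matrix `zᴴ * z` is unchanged when `z` is multiplied on the left by a unitary matrix `U`,
and Lebesgue measure is invariant under this multiplication (`measurePreserving_unitary_mul`), so
the law of `Z` is invariant (`map_unitary_mul_withDensity`). Since the orientation map commutes with
left multiplication by `U` (`orientation_unitary_mul`), the law of the orientation is invariant too.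

Lebesgue-almost every matrix has full column rank (`ae_rank_eq`), and then its orientation is
semi-unitary (`orientation_mem_stiefel`). Hence the law of the orientation is a left-invariant
probability measure carried by the Stiefel manifold. The unitary group is compact and acts
transitively there, so averaging over its Haar measure shows that only the uniform distribution has
these properties (`eq_stiefelUniform_of_map_unitary_mul_eq`).
-/

namespace ComplexStiefel

variable {m r : ℕ}

/-! ### Topology and Haar measure on spaces of matrices -/

instance instSecondCountableTopologyMatrix (m r : ℕ) :
    SecondCountableTopology (Matrix (Fin m) (Fin r) ℂ) :=
  inferInstanceAs (SecondCountableTopology (Fin m → Fin r → ℂ))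

instance instLocallyCompactSpaceMatrix (m r : ℕ) :
    LocallyCompactSpace (Matrix (Fin m) (Fin r) ℂ) :=
  inferInstanceAs (LocallyCompactSpace (Fin m → Fin r → ℂ))

instance instIsAddHaarMeasureVolumePi (m r : ℕ) :
    (volume : Measure (Fin m → Fin r → ℂ)).IsAddHaarMeasure :=
  Measure.instIsAddHaarMeasureForallVolumeOfMeasurableAddOfSigmaFinite

instance instIsAddHaarMeasureMatrix (m r : ℕ) :
    (volume : Measure (Matrix (Fin m) (Fin r) ℂ)).IsAddHaarMeasure :=
  instIsAddHaarMeasureVolumePi m r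

instance instSecondCountableTopologyUnitary (m : ℕ) :
    SecondCountableTopology (Matrix.unitaryGroup (Fin m) ℂ) :=
  TopologicalSpace.Subtype.secondCountableTopology
    (Matrix.unitaryGroup (Fin m) ℂ : Set (Matrix (Fin m) (Fin m) ℂ))

/-! ### Full column rank almost everywhere -/

/-- Along every complex line in the direction of `[I; 0]`, the determinant of the top `r × r` block
is the characteristic polynomial of a fixed matrix, so it has finitely many zeros. -/
theorem ae_det_submatrix_castLE_ne_zero (h : r ≤ m) :
    ∀ᵐ z : Matrix (Fin m) (Fin r) ℂ, (z.submatrix (Fin.castLE h) id).det ≠ 0 := by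
  let E : Fin m → Fin r → ℂ := fun i j => if i = Fin.castLE h j then 1 else 0
  let L : ℂ →ₗ[ℂ] (Fin m → Fin r → ℂ) := LinearMap.toSpanSingleton ℂ _ E
  have hcont : Continuous fun z : Fin m → Fin r → ℂ =>
      ((Matrix.of z).submatrix (Fin.castLE h) id).det := by
    refine Continuous.matrix_det ?_
    exact continuous_matrix fun i j => by
      simp only [submatrix_apply, of_apply]; fun_prop
  refine ae_mem_of_ae_add_linearMap_mem L volume (volume : Measure (Fin m → Fin r → ℂ))
    (s := {z | ((Matrix.of z).submatrix (Fin.castLE h) id).det ≠ 0})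
    (isOpen_ne_fun hcont continuous_const).measurableSet fun y => ?_
  let A : Matrix (Fin r) (Fin r) ℂ := (Matrix.of y).submatrix (Fin.castLE h) id
  have hfin : {t : ℂ | (-A).charpoly.IsRoot t}.Finite :=
    Polynomial.finite_setOfPred_isRoot (charpoly_monic _).ne_zero
  filter_upwards [compl_mem_ae_iff.mpr (hfin.measure_zero volume)] with t ht hdet
  refine ht ?_
  change Polynomial.eval t _ = 0
  rw [eval_charpoly, ← hdet]
  congr 1
  ext i j
  by_cases hij : i = j <;> simp [A, L, E, hij, add_comm]

theorem rank_eq_of_det_submatrix_ne_zero (h : r ≤ m) {z : Matrix (Fin m) (Fin r) ℂ}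
    (hz : (z.submatrix (Fin.castLE h) id).det ≠ 0) : z.rank = r := by
  refine le_antisymm (by simpa using z.rank_le_width) ?_
  have := rank_submatrix_le z (Fin.castLE h) (id : Fin r → Fin r)
  rwa [rank_of_isUnit _ ((isUnit_iff_isUnit_det _).mpr hz.isUnit), Fintype.card_fin] at this

theorem ae_rank_eq (h : r ≤ m) : ∀ᵐ z : Matrix (Fin m) (Fin r) ℂ, z.rank = r := by
  filter_upwards [ae_det_submatrix_castLE_ne_zero h] with z hz
  exact rank_eq_of_det_submatrix_ne_zero h hz

/-! ### The orientation map -/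

/-- The positive semidefinite square root is continuous on positive semidefinite matrices. -/
theorem continuous_sqrt_conjTranspose_mul_self :
    Continuous fun z : Matrix (Fin m) (Fin r) ℂ => CFC.sqrt (zᴴ * z) := by
  have hc : ContinuousOn CFC.sqrt {A : Matrix (Fin r) (Fin r) ℂ | 0 ≤ A} := by
    -- The C⋆-norm supplies the isometric functional calculus; its topology is the entrywise one.
    open scoped Matrix.Norms.L2Operator in exact CFC.continuousOn_sqrt
  exact hc.comp_continuous (by fun_prop) fun z => (posSemidef_conjTranspose_mul_self z).nonneg

theorem measurable_orientation : Measurable (orientation (m := m) (r := r)) := by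
  have hsqrt := continuous_sqrt_conjTranspose_mul_self (m := m) (r := r)
  have hinv : Measurable fun z : Matrix (Fin m) (Fin r) ℂ => (CFC.sqrt (zᴴ * z))⁻¹ := by
    simp only [inv_def, Ring.inverse_eq_inv']
    exact measurable_pi_iff.mpr fun i => measurable_pi_iff.mpr fun j =>
      hsqrt.matrix_det.measurable.inv.mul (hsqrt.matrix_adjugate.matrix_elem i j).measurable
  have hmul : Continuous fun p : Matrix (Fin m) (Fin r) ℂ × Matrix (Fin r) (Fin r) ℂ =>
      p.1 * p.2 := by fun_prop
  exact hmul.measurable.comp (measurable_id.prodMk hinv)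

theorem orientation_mem_stiefel {z : Matrix (Fin m) (Fin r) ℂ} (hz : z.rank = r) :
    orientation z ∈ stiefel m r := by
  have hsq : CFC.sqrt (zᴴ * z) * CFC.sqrt (zᴴ * z) = zᴴ * z :=
    CFC.sqrt_mul_sqrt_self _ (posSemidef_conjTranspose_mul_self z).nonneg
  have hS : (CFC.sqrt (zᴴ * z))ᴴ = CFC.sqrt (zᴴ * z) :=
    (CFC.sqrt_nonneg (zᴴ * z)).posSemidef.isHermitian
  have hu : IsUnit (zᴴ * z) := by
    rw [← mulVec_surjective_iff_isUnit]
    refine LinearMap.range_eq_top (f := (zᴴ * z).mulVecLin).mp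
      (Submodule.eq_top_of_finrank_eq ?_)
    change (zᴴ * z).rank = _
    rw [rank_conjTranspose_mul_self, hz, Module.finrank_fin_fun]
  have hdet : IsUnit (CFC.sqrt (zᴴ * z)).det := by
    rw [isUnit_iff_isUnit_det, ← hsq, det_mul] at hu
    exact isUnit_of_mul_isUnit_left hu
  change (z * (CFC.sqrt (zᴴ * z))⁻¹)ᴴ * (z * (CFC.sqrt (zᴴ * z))⁻¹) = 1
  rw [conjTranspose_mul, conjTranspose_nonsing_inv, hS]
  calc _ = (CFC.sqrt (zᴴ * z))⁻¹ * (zᴴ * z) * (CFC.sqrt (zᴴ * z))⁻¹ := by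
        simp only [Matrix.mul_assoc]
    _ = 1 := by
        nth_rw 2 [← hsq]
        rw [nonsing_inv_mul_cancel_left _ _ hdet, mul_nonsing_inv _ hdet]

theorem conjTranspose_mul_self_unitary_mul (U : Matrix.unitaryGroup (Fin m) ℂ)
    (z : Matrix (Fin m) (Fin r) ℂ) :
    ((U : Matrix (Fin m) (Fin m) ℂ) * z)ᴴ * ((U : Matrix (Fin m) (Fin m) ℂ) * z) = zᴴ * z := by
  have hU : (U : Matrix (Fin m) (Fin m) ℂ)ᴴ * (U : Matrix (Fin m) (Fin m) ℂ) = 1 :=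
    Matrix.mem_unitaryGroup_iff'.mp U.2
  rw [conjTranspose_mul, Matrix.mul_assoc, ← Matrix.mul_assoc _ (U : Matrix (Fin m) (Fin m) ℂ), hU,
    Matrix.one_mul]

theorem orientation_unitary_mul (U : Matrix.unitaryGroup (Fin m) ℂ)
    (z : Matrix (Fin m) (Fin r) ℂ) :
    orientation ((U : Matrix (Fin m) (Fin m) ℂ) * z) =
      (U : Matrix (Fin m) (Fin m) ℂ) * orientation z := by
  rw [orientation, conjTranspose_mul_self_unitary_mul, orientation, Matrix.mul_assoc]

/-! ### Unitary invariance of Lebesgue measure -/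

/-- Left multiplication by a unitary matrix, as a measurable equivalence of the space of `m × r`
matrices. -/
def unitaryMulEquiv (r : ℕ) (U : Matrix.unitaryGroup (Fin m) ℂ) :
    Matrix (Fin m) (Fin r) ℂ ≃ᵐ Matrix (Fin m) (Fin r) ℂ where
  toFun z := (U : Matrix (Fin m) (Fin m) ℂ) * z
  invFun z := (U : Matrix (Fin m) (Fin m) ℂ)ᴴ * z
  left_inv z := by
    beta_reduce
    rw [← Matrix.mul_assoc, ← star_eq_conjTranspose, Matrix.mem_unitaryGroup_iff'.mp U.2,
      Matrix.one_mul]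
  right_inv z := by
    beta_reduce
    rw [← Matrix.mul_assoc, ← star_eq_conjTranspose, Matrix.mem_unitaryGroup_iff.mp U.2,
      Matrix.one_mul]
  measurable_toFun := Continuous.measurable (by simp only [Equiv.coe_fn_mk]; fun_prop)
  measurable_invFun := Continuous.measurable (by simp only [Equiv.coe_fn_symm_mk]; fun_prop)

/-- The image of Lebesgue measure is again additive Haar, hence a multiple of Lebesgue measure. The
multiple is `1` because the Frobenius unit ball, described through the Gram matrix `zᴴ * z`, is
invariant and has positive finite volume. -/
theorem measurePreserving_unitary_mul (U : Matrix.unitaryGroup (Fin m) ℂ) :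
    MeasurePreserving (unitaryMulEquiv r U) volume volume := by
  refine ⟨(unitaryMulEquiv r U).measurable, ?_⟩
  let e : Matrix (Fin m) (Fin r) ℂ ≃+ Matrix (Fin m) (Fin r) ℂ :=
    { (unitaryMulEquiv r U).toEquiv with map_add' := fun x y => Matrix.mul_add _ x y }
  have : (Measure.map (unitaryMulEquiv r U)
      (volume : Measure (Matrix (Fin m) (Fin r) ℂ))).IsAddHaarMeasure :=
    e.isAddHaarMeasure_map volume
      (by change Continuous fun z => (U : Matrix (Fin m) (Fin m) ℂ) * z; fun_prop)
      (by change Continuous fun z => (U : Matrix (Fin m) (Fin m) ℂ)ᴴ * z; fun_prop)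
  have hc := Measure.isAddLeftInvariant_eq_smul
    (Measure.map (unitaryMulEquiv r U) volume) volume
  have hgram : Continuous fun z : Matrix (Fin m) (Fin r) ℂ => (zᴴ * z).trace.re :=
    Complex.continuous_re.comp (Continuous.matrix_trace (by fun_prop))
  -- The trace of the Gram matrix is the squared Frobenius norm.
  let K : Set (Matrix (Fin m) (Fin r) ℂ) := {z | (zᴴ * z).trace.re ≤ 1}
  have hK : IsClosed K := isClosed_le hgram continuous_const
  have hKcompact : IsCompact K := by
    have hbox : IsCompact (Set.univ.pi fun _ : Fin m => Set.univ.pi fun _ : Fin r =>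
        Metric.closedBall (0 : ℂ) 1) :=
      isCompact_univ_pi fun _ => isCompact_univ_pi fun _ => isCompact_closedBall _ _
    refine IsCompact.of_isClosed_subset hbox hK fun z hz i _ j _ => ?_
    have htrace : (zᴴ * z).trace.re = ∑ j, ∑ i, ‖z i j‖ ^ 2 := by
      simp [trace, mul_apply, ← Complex.normSq_eq_norm_sq, Complex.normSq_apply]
    have hle : ‖z i j‖ ^ 2 ≤ 1 := calc
      _ ≤ ∑ i, ‖z i j‖ ^ 2 := Finset.single_le_sum (f := fun i => ‖z i j‖ ^ 2)
          (fun _ _ => by positivity) (Finset.mem_univ i)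
      _ ≤ ∑ j, ∑ i, ‖z i j‖ ^ 2 := Finset.single_le_sum (f := fun j => ∑ i, ‖z i j‖ ^ 2)
          (fun _ _ => by positivity) (Finset.mem_univ j)
      _ ≤ 1 := htrace ▸ hz
    simpa using (sq_le_one_iff₀ (norm_nonneg _)).mp hle
  have hKpos : volume K ≠ 0 := by
    have hopen : IsOpen {z : Matrix (Fin m) (Fin r) ℂ | (zᴴ * z).trace.re < 1} :=
      isOpen_lt hgram continuous_const
    have hsub : {z : Matrix (Fin m) (Fin r) ℂ | (zᴴ * z).trace.re < 1} ⊆ K :=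
      fun z (hz : (zᴴ * z).trace.re < 1) => show (zᴴ * z).trace.re ≤ 1 from hz.le
    exact fun h0 => (hopen.measure_pos volume ⟨0, by simp⟩).ne' (measure_mono_null hsub h0)
  have hKinv : unitaryMulEquiv r U ⁻¹' K = K := by
    ext z
    change (((U : Matrix (Fin m) (Fin m) ℂ) * z)ᴴ *
      ((U : Matrix (Fin m) (Fin m) ℂ) * z)).trace.re ≤ 1 ↔ _
    rw [conjTranspose_mul_self_unitary_mul]
    rfl
  have hmass := congrArg (fun ν => ν K) hc
  simp only [Measure.map_apply (unitaryMulEquiv r U).measurable hK.measurableSet, hKinv,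
    Measure.smul_apply, ENNReal.smul_def, smul_eq_mul] at hmass
  have hone : ((Measure.map (unitaryMulEquiv r U) volume).addHaarScalarFactor
      (volume : Measure (Matrix (Fin m) (Fin r) ℂ)) : ENNReal) = 1 :=
    ((ENNReal.mul_eq_right hKpos hKcompact.measure_lt_top.ne).mp hmass.symm)
  rw [hc, ENNReal.coe_eq_one.mp hone, one_smul]

/-- A distribution whose density depends on `z` only through `zᴴ * z` is invariant under left
multiplication by unitary matrices. -/
theorem map_unitary_mul_withDensity (U : Matrix.unitaryGroup (Fin m) ℂ)
    (g : Matrix (Fin r) (Fin r) ℂ → ENNReal) :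
    (volume.withDensity fun z : Matrix (Fin m) (Fin r) ℂ => g (zᴴ * z)).map
        (unitaryMulEquiv r U) =
      volume.withDensity fun z => g (zᴴ * z) := by
  ext s hs
  rw [Measure.map_apply (unitaryMulEquiv r U).measurable hs, withDensity_apply _ hs,
    withDensity_apply _ ((unitaryMulEquiv r U).measurable hs),
    ← (measurePreserving_unitary_mul U).setLIntegral_comp_preimage_emb
      (unitaryMulEquiv r U).measurableEmbedding _ s]
  refine lintegral_congr fun z => ?_
  exact congrArg g (conjTranspose_mul_self_unitary_mul U z).symm

/-! ### Uniqueness of the invariant distribution -/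

/-- Right translation takes the Haar probability measure to a left-invariant probability measure, so
compactness makes `U(m)` unimodular. -/
theorem isMulRightInvariant_unitaryHaar (m : ℕ) : (unitaryHaar m).IsMulRightInvariant := by
  refine ⟨fun V => ?_⟩
  have : (unitaryHaar m).IsHaarMeasure := inferInstanceAs (Measure.haarMeasure _).IsHaarMeasure
  have : IsProbabilityMeasure ((unitaryHaar m).map (· * V)) :=
    Measure.isProbabilityMeasure_map (measurable_mul_const V).aemeasurable
  exact Measure.isHaarMeasure_eq_of_isProbabilityMeasure _ _

/-- The unitary group acts transitively on the Stiefel manifold: the orthonormal columns of `X`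
extend to an orthonormal basis. -/
theorem exists_firstColumns_eq (h : r ≤ m) {X : Matrix (Fin m) (Fin r) ℂ} (hX : X ∈ stiefel m r) :
    ∃ V : Matrix.unitaryGroup (Fin m) ℂ, (firstColumns h V : Matrix (Fin m) (Fin r) ℂ) = X := by
  -- The columns of `X`, padded with zero vectors that the orthonormal extension discards.
  let v : Fin m → EuclideanSpace ℂ (Fin m) := fun k =>
    WithLp.toLp 2 fun i => if hk : (k : ℕ) < r then X i ⟨k, hk⟩ else 0
  have hv : Orthonormal ℂ ((Set.range (Fin.castLE h)).domRestrict v) := by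
    rw [orthonormal_iff_ite]
    rintro ⟨_, j, rfl⟩ ⟨_, k, rfl⟩
    have hjk := congrFun (congrFun hX j) k
    have hiff : ((⟨Fin.castLE h j, j, rfl⟩ : Set.range (Fin.castLE h)) =
        ⟨Fin.castLE h k, k, rfl⟩) ↔ j = k := by simp [Subtype.ext_iff]
    rw [if_congr hiff rfl rfl]
    simpa [v, PiLp.inner_apply, mul_apply, one_apply, mul_comm] using hjk
  obtain ⟨b, hb⟩ := hv.exists_orthonormalBasis_extension_of_card_eq (by simp)
  refine ⟨⟨_, (EuclideanSpace.basisFun (Fin m) ℂ).toMatrix_orthonormalBasis_mem_unitary b⟩, ?_⟩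
  ext i j
  simp [firstColumns, Module.Basis.toMatrix_apply, hb _ ⟨j, rfl⟩, v]

/-- The uniform distribution is the only left-invariant probability measure carried by the Stiefel
manifold. Both sides are compared with the average of `μ {X | U * X ∈ s}` over `U`: integrating first
over `X` gives `μ s` by invariance, integrating first over `U` gives the uniform mass of `s`. -/
theorem eq_stiefelUniform_of_map_unitary_mul_eq (h : r ≤ m)
    (μ : Measure (Matrix (Fin m) (Fin r) ℂ)) [IsProbabilityMeasure μ]
    (hμ : ∀ᵐ X ∂μ, X ∈ stiefel m r)
    (hinv : ∀ U : Matrix.unitaryGroup (Fin m) ℂ, μ.map (unitaryMulEquiv r U) = μ) :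
    μ = (stiefelUniform h).map Subtype.val := by
  ext s hs
  have hmul : Measurable fun p : Matrix.unitaryGroup (Fin m) ℂ × Matrix (Fin m) (Fin r) ℂ =>
      (p.1 : Matrix (Fin m) (Fin m) ℂ) * p.2 := Continuous.measurable (by fun_prop)
  have hR := isMulRightInvariant_unitaryHaar m
  -- The proportion of rotations carrying a given semi-unitary matrix into `s` does not depend on
  -- that matrix, by right invariance of the Haar measure.
  have horbit : ∀ X ∈ stiefel m r,
      unitaryHaar m {U | (U : Matrix (Fin m) (Fin m) ℂ) * X ∈ s} =
        (stiefelUniform h).map Subtype.val s := by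
    intro X hX
    obtain ⟨V, rfl⟩ := exists_firstColumns_eq h hX
    rw [Measure.map_apply measurable_subtype_coe hs, stiefelUniform,
      Measure.map_apply (measurable_firstColumns h) (measurable_subtype_coe hs),
      ← measure_preimage_mul_right (unitaryHaar m) V (firstColumns h ⁻¹' _)]
    congr 1
  calc μ s = ∫⁻ U, μ (unitaryMulEquiv r U ⁻¹' s) ∂(unitaryHaar m) := by
        rw [← mul_one (μ s), ← measure_univ (μ := unitaryHaar m), ← lintegral_const]
        refine lintegral_congr fun U => ?_
        rw [← Measure.map_apply (unitaryMulEquiv r U).measurable hs, hinv]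
    _ = ((unitaryHaar m).prod μ) {p | (p.1 : Matrix (Fin m) (Fin m) ℂ) * p.2 ∈ s} :=
        (Measure.prod_apply (hmul hs)).symm
    _ = ∫⁻ X, unitaryHaar m {U | (U : Matrix (Fin m) (Fin m) ℂ) * X ∈ s} ∂μ :=
        Measure.prod_apply_symm (hmul hs)
    _ = ∫⁻ _, (stiefelUniform h).map Subtype.val s ∂μ :=
        lintegral_congr_ae (hμ.mono horbit)
    _ = (stiefelUniform h).map Subtype.val s := by simp

end ComplexStiefel

/-! ### The law of the orientation -/

theorem mainTheorem2 {Ω : Type*} [MeasurableSpace Ω] (P : Measure Ω) [IsProbabilityMeasure P]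
    (m r : ℕ) (hrm : r ≤ m) (Z : Ω → Matrix (Fin m) (Fin r) ℂ)
    (g : Matrix (Fin r) (Fin r) ℂ → ENNReal)
    (hg : AEMeasurable (fun z : Matrix (Fin m) (Fin r) ℂ => g (zᴴ * z)) volume)
    (hZ : HasLaw Z (volume.withDensity fun z : Matrix (Fin m) (Fin r) ℂ => g (zᴴ * z)) P) :
    (∀ᵐ ω ∂P, (Z ω).rank = r ∧ ComplexStiefel.orientation (Z ω) ∈ ComplexStiefel.stiefel m r) ∧
      HasLaw (fun ω => ComplexStiefel.orientation (Z ω))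
        ((ComplexStiefel.stiefelUniform hrm).map Subtype.val) P := by
  have hH : AEMeasurable (fun ω => ComplexStiefel.orientation (Z ω)) P :=
    ComplexStiefel.measurable_orientation.comp_aemeasurable hZ.aemeasurable
  have hrank : ∀ᵐ ω ∂P, (Z ω).rank = r := by
    refine ae_of_ae_map hZ.aemeasurable (p := fun z => z.rank = r) ?_
    rw [hZ.map_eq]
    exact (withDensity_absolutelyContinuous _ _).ae_le (ComplexStiefel.ae_rank_eq hrm)
  have hstiefel : ∀ᵐ ω ∂P, ComplexStiefel.orientation (Z ω) ∈ ComplexStiefel.stiefel m r :=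
    hrank.mono fun ω hω => ComplexStiefel.orientation_mem_stiefel hω
  refine ⟨hrank.and hstiefel, hH, ?_⟩
  have : IsProbabilityMeasure (P.map fun ω => ComplexStiefel.orientation (Z ω)) :=
    Measure.isProbabilityMeasure_map hH
  refine ComplexStiefel.eq_stiefelUniform_of_map_unitary_mul_eq hrm _ ?_ fun U => ?_
  · have hclosed : IsClosed (ComplexStiefel.stiefel m r) :=
      isClosed_eq (by fun_prop) continuous_const
    exact (ae_map_iff hH hclosed.measurableSet).mpr hstiefel
  · have hlaw : P.map (fun ω => ComplexStiefel.orientation (Z ω)) =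
        (volume.withDensity fun z : Matrix (Fin m) (Fin r) ℂ => g (zᴴ * z)).map
          ComplexStiefel.orientation := by
      rw [← hZ.map_eq, AEMeasurable.map_map_of_aemeasurable
        ComplexStiefel.measurable_orientation.aemeasurable hZ.aemeasurable]
      rfl
    rw [hlaw]
    nth_rw 2 [← ComplexStiefel.map_unitary_mul_withDensity U g]
    rw [Measure.map_map (ComplexStiefel.unitaryMulEquiv r U).measurable
        ComplexStiefel.measurable_orientation,
      Measure.map_map ComplexStiefel.measurable_orientation
        (ComplexStiefel.unitaryMulEquiv r U).measurable]
    congr 1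
    funext z
    exact (ComplexStiefel.orientation_unitary_mul U z).symm
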